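/- Let $\mathrm{GL}^+(2)$ be the set of real $2\times 2$ matrices with positive determinant. For $F\in\mathrm{GL}^+(2)$ let $\lambda_{\max}\ge\lambda_{\min}>0$ be its singular values, $\|F\|=\lambda_{\max}$ its Euclidean operator norm and $K(F)=\|F\|^2/\det F=\lambda_{\max}/\lambda_{\min}$; note that $\det F=\lambda_{\max}\lambda_{\min}$. Let $$W_0(F)=\frac{\lambda_{\max}}{\lambda_{\min}}-\log\Bigl(\frac{\lambda_{\max}}{\lambda_{\min}}\Bigr)+\log(\lambda_{\max}\lambda_{\min})+\frac{1}{\lambda_{\max}\lambda_{\min}}=\hat h(K(F))+f(\det F),\qquad F\in\mathrm{GL}^+(2),$$ with $\hat h(t)=t-\log t$ and $f(t)=\log t+\frac1t$. Then: 1. $W_0$ is objective and isotropic: $W_0(Q_1FQ_2)=W_0(F)$ for all $F\in\mathrm{GL}^+(2)$ and $Q_1,Q_2\in\mathrm{SO}(2)$. 2. $W_0$ is rank-one convex: $W_0((1-t)F+t(F+H))\le(1-t)W_0(F)+tW_0(F+H)$ for all $t\in[0,1]$, all $F\in\mathrm{GL}^+(2)$ and all $H\in\mathbb R^{2\times2}$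 with $\operatorname{rank}H=1$ and $F+H\in\mathrm{GL}^+(2)$. 3. For every $c\in\mathbb R$ the sublevel set $\{F\in\mathbb R^{2\times2}: \det F>0,\ W_0(F)\le c\}$ is compact and connected (the empty set counting as connected). 4. $W_0$ is not polyconvex: there is no convex function $P:\mathbb R^{2\times2}\times\mathbb R\to\mathbb R\cup\{+\infty\}$ with $W_0(F)=P(F,\det F)$ for all $F\in\mathrm{GL}^+(2)$. -/

import Mathlib

noncomputable section

namespace PlanarEnergy

/-- Real `2 × 2` matrices. -/
abbrev Mat : Type := Matrix (Fin 2) (Fin 2) ℝ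

/-- The set `GL⁺(2)` of real `2 × 2` matrices with positive determinant. Energies on `GL⁺(2)` are
written as functions on all matrices; every notion below only looks at their values on `GL⁺(2)`. -/
def GLp : Set Mat := {F | 0 < F.det}

/-- `W` is objective and isotropic on `GL⁺(2)`: invariant under left and right rotations. -/
def IsObjectiveIsotropic (W : Mat → ℝ) : Prop :=
  ∀ F ∈ GLp, ∀ Q₁ ∈ Matrix.specialOrthogonalGroup (Fin 2) ℝ,
    ∀ Q₂ ∈ Matrix.specialOrthogonalGroup (Fin 2) ℝ, W (Q₁ * F * Q₂) = W F

/-- `W` is rank-one convex on `GL⁺(2)`: it is convex along every segment with endpoints in `GL⁺(2)`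
and direction of rank one. Such a segment stays in `GL⁺(2)`, because the determinant is affine
along it. -/
def IsRankOneConvex (W : Mat → ℝ) : Prop :=
  ∀ F ∈ GLp, ∀ H : Mat, H.rank = 1 → F + H ∈ GLp → ∀ t ∈ Set.Icc (0 : ℝ) 1,
    W ((1 - t) • F + t • (F + H)) ≤ (1 - t) * W F + t * W (F + H)

/-- Convexity of a function on a real vector space with values in `ℝ ∪ {+∞}`
(in `WithTop ℝ` one has `0 * ⊤ = 0`, and `a * ⊤ = ⊤` for `a > 0`). -/
def IsConvexExt {E : Type*} [AddCommGroup E] [Module ℝ E] (P : E → WithTop ℝ) : Prop :=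
  ∀ x y : E, ∀ a b : ℝ, 0 ≤ a → 0 ≤ b → a + b = 1 →
    P (a • x + b • y) ≤ (a : WithTop ℝ) * P x + (b : WithTop ℝ) * P y

/-- `W` is polyconvex on `GL⁺(2)`: `W F = P (F, det F)` for a convex `P : ℝ^{2×2} × ℝ → ℝ ∪ {+∞}`. -/
def IsPolyconvex (W : Mat → ℝ) : Prop :=
  ∃ P : Mat × ℝ → WithTop ℝ, IsConvexExt P ∧ ∀ F ∈ GLp, P (F, F.det) = (W F : WithTop ℝ)

/-- The sublevel set `{F ∈ ℝ^{2×2} | det F > 0, W F ≤ c}`. -/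
def sublevel (W : Mat → ℝ) (c : ℝ) : Set Mat := {F | F ∈ GLp ∧ W F ≤ c}

/-- The largest singular value. -/
def lamMax (F : Mat) : ℝ := (Matrix.toEuclideanLin F).singularValues 0

/-- The smallest singular value. -/
def lamMin (F : Mat) : ℝ := (Matrix.toEuclideanLin F).singularValues 1

/-- The Euclidean operator norm. -/
def euclOpNorm (F : Mat) : ℝ := ‖Matrix.toEuclideanCLM (n := Fin 2) (𝕜 := ℝ) F‖

/-- The linear distortion `K F = ‖F‖² / det F`. -/
def distortion (F : Mat) : ℝ := euclOpNorm F ^ 2 / F.det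

/-- The isochoric part `t - log t`. -/
def hHat (t : ℝ) : ℝ := t - Real.log t

/-- The volumetric part `log t + 1 / t`. -/
def fVol (t : ℝ) : ℝ := Real.log t + 1 / t

/-- The energy `W₀`, in terms of the singular values. -/
def W₀ (F : Mat) : ℝ :=
  lamMax F / lamMin F - Real.log (lamMax F / lamMin F) + Real.log (lamMax F * lamMin F)
    + 1 / (lamMax F * lamMin F)

end PlanarEnergy

end

noncomputable section

namespace PlanarEnergy

/-! On `GLp` the singular values are `‖conf F‖ ± ‖anti F‖`, and `W₀` is `x / y + 2 log y + 1 / (x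
y)` for singular values `x ≥ y`.

Rank-one convexity comes from supporting functions. The determinant is affine along rank-one lines,
so `1 / det` is convex there; for the rest, `rankOneSupport G` is affine along these lines, touches
at `G` (`rankOneSupport_self`) and lies below on the rank-one cone through `G`
(`rankOneSupport_le`). This rests on a scalar inequality valid for `1 ≤ x`, a range that the cone
guarantees.

For sublevel sets, `polarMatrix` uses two angles and half the logarithms of distortion and
determinant. In the latter two the energy is convex and coercive, so each sublevel set is a
continuous image of a compact convex set.

Polyconvexity fails at `18 • 1`: a convex combination of three matrices that also averages the
determinants has smaller mean energy. -/

/-! ### Singular values through conformal and anticonformal parts -/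

/-- The conformal part of a matrix, as a complex number. -/
def conf (F : Mat) : ℂ := ⟨(F 0 0 + F 1 1) / 2, (F 1 0 - F 0 1) / 2⟩

/-- The anticonformal part of a matrix, as a complex number. -/
def anti (F : Mat) : ℂ := ⟨(F 0 0 - F 1 1) / 2, (F 1 0 + F 0 1) / 2⟩

lemma norm_conf_sq (F : Mat) :
    ‖conf F‖ ^ 2 = ((F 0 0 + F 1 1) / 2) ^ 2 + ((F 1 0 - F 0 1) / 2) ^ 2 := by
  rw [Complex.sq_norm, Complex.normSq_apply, conf]; ring

lemma norm_anti_sq (F : Mat) :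
    ‖anti F‖ ^ 2 = ((F 0 0 - F 1 1) / 2) ^ 2 + ((F 1 0 + F 0 1) / 2) ^ 2 := by
  rw [Complex.sq_norm, Complex.normSq_apply, anti]; ring

lemma det_eq (F : Mat) : F.det = ‖conf F‖ ^ 2 - ‖anti F‖ ^ 2 := by
  rw [norm_conf_sq, norm_anti_sq, Matrix.det_fin_two]; ring

lemma trace_transpose_mul_self (F : Mat) :
    (F.transpose * F).trace = 2 * (‖conf F‖ ^ 2 + ‖anti F‖ ^ 2) := by
  rw [norm_conf_sq, norm_anti_sq, Matrix.trace_fin_two]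
  simp only [Matrix.mul_apply, Fin.sum_univ_two, Matrix.transpose_apply]
  ring

lemma adjoint_comp_self_toEuclideanLin (F : Mat) :
    LinearMap.adjoint (Matrix.toEuclideanLin F) ∘ₗ Matrix.toEuclideanLin F
      = Matrix.toLin (PiLp.basisFun 2 ℝ (Fin 2)) (PiLp.basisFun 2 ℝ (Fin 2))
          (F.transpose * F) := by
  rw [← Matrix.toEuclideanLin_conjTranspose_eq_adjoint, Matrix.toEuclideanLin,
    Matrix.toLpLin_eq_toLin,
    ← Matrix.toLin_mul, Matrix.conjTranspose_eq_transpose_of_trivial]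

lemma lamMax_sq_mul_lamMin_sq (F : Mat) : lamMax F ^ 2 * lamMin F ^ 2 = F.det ^ 2 := by
  have hs := (Matrix.toEuclideanLin F).isSymmetric_adjoint_comp_self
  have hn : Module.finrank ℝ (EuclideanSpace ℝ (Fin 2)) = 2 := by simp
  have h := (congrArg LinearMap.det (adjoint_comp_self_toEuclideanLin F)).symm.trans
    (hs.det_eq_prod_eigenvalues hn)
  rw [LinearMap.det_toLin, Fin.prod_univ_two] at h
  rw [lamMax, lamMin, (Matrix.toEuclideanLin F).sq_singularValues_of_lt hn (by norm_num : 0 < 2),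
    (Matrix.toEuclideanLin F).sq_singularValues_of_lt hn (by norm_num : 1 < 2)]
  rw [Matrix.det_mul, Matrix.det_transpose] at h
  rw [pow_two, h]
  rfl

lemma lamMax_sq_add_lamMin_sq (F : Mat) :
    lamMax F ^ 2 + lamMin F ^ 2 = (F.transpose * F).trace := by
  have hs := (Matrix.toEuclideanLin F).isSymmetric_adjoint_comp_self
  have hn : Module.finrank ℝ (EuclideanSpace ℝ (Fin 2)) = 2 := by simp
  have h := LinearMap.trace_eq_matrix_trace ℝ (hs.eigenvectorBasis hn).toBasis
    (LinearMap.adjoint (Matrix.toEuclideanLin F) ∘ₗ Matrix.toEuclideanLin F)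
  rw [hs.toMatrix_eigenvectorBasis hn] at h
  replace h := (congrArg (LinearMap.trace ℝ _) (adjoint_comp_self_toEuclideanLin F)).symm.trans h
  rw [LinearMap.trace_eq_matrix_trace ℝ (PiLp.basisFun 2 ℝ (Fin 2)), LinearMap.toMatrix_toLin,
    Matrix.trace_diagonal, Fin.sum_univ_two] at h
  rw [lamMax, lamMin, (Matrix.toEuclideanLin F).sq_singularValues_of_lt hn (by norm_num : 0 < 2),
    (Matrix.toEuclideanLin F).sq_singularValues_of_lt hn (by norm_num : 1 < 2), h]
  rfl

lemma lamMin_le_lamMax (F : Mat) : lamMin F ≤ lamMax F :=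
  (Matrix.toEuclideanLin F).singularValues_antitone zero_le_one

lemma lamMin_nonneg (F : Mat) : 0 ≤ lamMin F :=
  (Matrix.toEuclideanLin F).singularValues_nonneg 1

lemma norm_anti_lt_norm_conf {F : Mat} (hF : F ∈ GLp) : ‖anti F‖ < ‖conf F‖ := by
  have h : 0 < F.det := hF
  rw [det_eq] at h
  exact lt_of_pow_lt_pow_left₀ 2 (norm_nonneg _) (by linarith)

lemma lamMax_mul_lamMin {F : Mat} (hF : F ∈ GLp) : lamMax F * lamMin F = F.det := by
  have h : 0 < F.det := hF
  have h0 := lamMin_nonneg F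
  have h1 := h0.trans (lamMin_le_lamMax F)
  refine (pow_left_inj₀ (mul_nonneg h1 h0) h.le two_ne_zero).1 ?_
  rw [mul_pow, lamMax_sq_mul_lamMin_sq]

lemma lamMax_add_lamMin {F : Mat} (hF : F ∈ GLp) : lamMax F + lamMin F = 2 * ‖conf F‖ := by
  have h0 := lamMin_nonneg F
  have h1 := h0.trans (lamMin_le_lamMax F)
  refine (pow_left_inj₀ (add_nonneg h1 h0) (by positivity) two_ne_zero).1 ?_
  linear_combination lamMax_sq_add_lamMin_sq F + trace_transpose_mul_self F
    + 2 * lamMax_mul_lamMin hF + 2 * det_eq F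

lemma lamMax_sub_lamMin {F : Mat} (hF : F ∈ GLp) : lamMax F - lamMin F = 2 * ‖anti F‖ := by
  refine (pow_left_inj₀ (sub_nonneg.2 (lamMin_le_lamMax F)) (by positivity) two_ne_zero).1 ?_
  linear_combination lamMax_sq_add_lamMin_sq F + trace_transpose_mul_self F
    - 2 * lamMax_mul_lamMin hF - 2 * det_eq F

lemma lamMax_eq {F : Mat} (hF : F ∈ GLp) : lamMax F = ‖conf F‖ + ‖anti F‖ := by
  linarith [lamMax_add_lamMin hF, lamMax_sub_lamMin hF]

lemma lamMin_eq {F : Mat} (hF : F ∈ GLp) : lamMin F = ‖conf F‖ - ‖anti F‖ := by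
  linarith [lamMax_add_lamMin hF, lamMax_sub_lamMin hF]

lemma lamMin_pos {F : Mat} (hF : F ∈ GLp) : 0 < lamMin F := by
  rw [lamMin_eq hF]; linarith [norm_anti_lt_norm_conf hF]

lemma lamMax_pos {F : Mat} (hF : F ∈ GLp) : 0 < lamMax F :=
  (lamMin_pos hF).trans_le (lamMin_le_lamMax F)

lemma norm_toEuclideanLin_le (F : Mat) (v : EuclideanSpace ℝ (Fin 2)) :
    ‖Matrix.toEuclideanLin F v‖ ≤ lamMax F * ‖v‖ := by
  have h0 := lamMin_nonneg F
  have h01 := lamMin_le_lamMax F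
  refine le_of_sq_le_sq ?_ (mul_nonneg (h0.trans h01) (norm_nonneg _))
  have hs := lamMax_sq_add_lamMin_sq F
  have hp := lamMax_sq_mul_lamMin_sq F
  rw [Matrix.trace_fin_two] at hs
  rw [Matrix.det_fin_two] at hp
  simp only [Matrix.mul_apply, Fin.sum_univ_two, Matrix.transpose_apply] at hs
  rw [mul_pow, EuclideanSpace.norm_sq_eq, EuclideanSpace.norm_sq_eq]
  simp only [Fin.sum_univ_two, Real.norm_eq_abs, sq_abs, Matrix.toLpLin_apply,
    Matrix.mulVec, dotProduct]
  set x := lamMax F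
  set y := lamMin F
  set p := F 0 0
  set q := F 0 1
  set r := F 1 0
  set s := F 1 1
  have hxy : y ^ 2 ≤ x ^ 2 := pow_le_pow_left₀ h0 h01 2
  -- `a`, `b`, `c` are the entries of `x ^ 2 • 1 - Fᵀ F`, which has determinant zero and trace `x ^
  -- 2 - y ^ 2 ≥ 0`, hence is positive semidefinite.
  obtain ⟨a, ha⟩ : ∃ a, a = x ^ 2 - p ^ 2 - r ^ 2 := ⟨_, rfl⟩
  obtain ⟨b, hb⟩ : ∃ b, b = -(p * q + r * s) := ⟨_, rfl⟩
  obtain ⟨c, hc⟩ : ∃ c, c = x ^ 2 - q ^ 2 - s ^ 2 := ⟨_, rfl⟩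
  have hac : a + c = x ^ 2 - y ^ 2 := by rw [ha, hc]; linarith
  have hdet : a * c = b ^ 2 := by rw [ha, hb, hc]; linear_combination x ^ 2 * hs - hp
  have key : 0 ≤ a * v 0 ^ 2 + 2 * b * (v 0 * v 1) + c * v 1 ^ 2 := by
    rcases (sub_nonneg.2 hxy).eq_or_lt with h | h
    · have hca : c = -a := by linarith
      have ha2 : a ^ 2 + b ^ 2 = 0 := by rw [← hdet, hca]; ring
      have ha0 : a = 0 := by nlinarith [sq_nonneg a, sq_nonneg b]
      have hb0 : b = 0 := by nlinarith [sq_nonneg a, sq_nonneg b]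
      simp [hca, ha0, hb0]
    · refine nonneg_of_mul_nonneg_right (b := a * v 0 ^ 2 + 2 * b * (v 0 * v 1) + c * v 1 ^ 2)
        (a := a + c) ?_ (by linarith)
      -- For a symmetric 2 × 2 matrix `M` of determinant zero, `M ^ 2 = (trace M) • M`, so trace
      -- times the quadratic form is `‖M v‖ ^ 2`.
      have : (a + c) * (a * v 0 ^ 2 + 2 * b * (v 0 * v 1) + c * v 1 ^ 2)
          = (a * v 0 + b * v 1) ^ 2 + (b * v 0 + c * v 1) ^ 2 := by
        linear_combination (v 0 ^ 2 + v 1 ^ 2) * hdet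
      rw [this]; positivity
  rw [ha, hb, hc] at key
  linarith

lemma lamMax_eq_euclOpNorm (F : Mat) : lamMax F = euclOpNorm F := by
  have h1 : 0 ≤ lamMax F := (lamMin_nonneg F).trans (lamMin_le_lamMax F)
  have happ (v) : Matrix.toEuclideanCLM (n := Fin 2) (𝕜 := ℝ) F v = Matrix.toEuclideanLin F v := rfl
  refine le_antisymm ?_ (ContinuousLinearMap.opNorm_le_bound _ h1 (norm_toEuclideanLin_le F))
  obtain ⟨v, hv⟩ :=
    ((Matrix.toEuclideanLin F).hasEigenvalue_adjoint_comp_self_sq_singularValues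
      (n := 0) (by simp)).exists_hasEigenvector
  have hv0 : 0 < ‖v‖ := norm_pos_iff.2 hv.2
  have hFv : ‖Matrix.toEuclideanLin F v‖ = lamMax F * ‖v‖ := by
    refine (pow_left_inj₀ (norm_nonneg _) (by positivity) two_ne_zero).1 ?_
    have := hv.apply_eq_smul
    rw [← real_inner_self_eq_norm_sq, ← LinearMap.adjoint_inner_left, ← LinearMap.comp_apply, this,
      real_inner_smul_left, real_inner_self_eq_norm_sq, mul_pow]
    rfl
  have := (Matrix.toEuclideanCLM (n := Fin 2) (𝕜 := ℝ) F).le_opNorm v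
  rw [happ, hFv] at this
  exact le_of_mul_le_mul_right this hv0

/-! ### Formulas for the energy and its invariance -/

lemma W₀_eq {F : Mat} (hF : F ∈ GLp) :
    W₀ F = lamMax F / lamMin F + 2 * Real.log (lamMin F) + 1 / F.det := by
  rw [W₀, Real.log_div (lamMax_pos hF).ne' (lamMin_pos hF).ne',
    Real.log_mul (lamMax_pos hF).ne' (lamMin_pos hF).ne', lamMax_mul_lamMin hF]
  ring

lemma W₀_eq_hHat_add_fVol {F : Mat} (hF : F ∈ GLp) :
    W₀ F = hHat (distortion F) + fVol F.det := by
  have h : distortion F = lamMax F / lamMin F := by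
    rw [distortion, ← lamMax_eq_euclOpNorm, ← lamMax_mul_lamMin hF]
    have := (lamMax_pos hF).ne'
    have := (lamMin_pos hF).ne'
    field_simp
  rw [h, hHat, fVol, W₀, lamMax_mul_lamMin hF]
  ring

/-- Rotations preserve the determinant and the trace of `Fᵀ F`, and these two determine `‖conf F‖`
and `‖anti F‖`. -/
lemma isObjectiveIsotropic_W₀ : IsObjectiveIsotropic W₀ := by
  intro F hF Q₁ hQ₁ Q₂ hQ₂
  obtain ⟨h₁, d₁⟩ := Matrix.mem_specialOrthogonalGroup_iff.1 hQ₁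
  obtain ⟨h₂, d₂⟩ := Matrix.mem_specialOrthogonalGroup_iff.1 hQ₂
  rw [Matrix.mem_orthogonalGroup_iff'] at h₁
  rw [Matrix.mem_orthogonalGroup_iff] at h₂
  have hdet : (Q₁ * F * Q₂).det = F.det := by simp [d₁, d₂]
  have htr : ((Q₁ * F * Q₂).transpose * (Q₁ * F * Q₂)).trace = (F.transpose * F).trace := by
    have h : (Q₁ * F * Q₂).transpose * (Q₁ * F * Q₂)
        = Q₂.transpose * (F.transpose * (Q₁.transpose * Q₁) * F * Q₂) := by
      simp only [Matrix.transpose_mul, Matrix.mul_assoc]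
    rw [h, Matrix.trace_mul_comm, Matrix.mul_assoc, h₂, h₁]
    simp
  have hG : Q₁ * F * Q₂ ∈ GLp := by
    change 0 < (Q₁ * F * Q₂).det
    rw [hdet]; exact hF
  rw [trace_transpose_mul_self, trace_transpose_mul_self] at htr
  have hd := hdet
  rw [det_eq, det_eq] at hd
  have hc : ‖conf (Q₁ * F * Q₂)‖ = ‖conf F‖ :=
    (pow_left_inj₀ (norm_nonneg _) (norm_nonneg _) two_ne_zero).1 (by linarith)
  have ha : ‖anti (Q₁ * F * Q₂)‖ = ‖anti F‖ :=
    (pow_left_inj₀ (norm_nonneg _) (norm_nonneg _) two_ne_zero).1 (by linarith)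
  rw [W₀_eq hG, W₀_eq hF, lamMax_eq hG, lamMin_eq hG, lamMax_eq hF, lamMin_eq hF, hdet, hc, ha]

/-! ### Rank-one convexity -/

/-- The gap is increasing in `x`, so it suffices to take `x = max 1 y`. What remains is `s ≤ sinh s`
at `s = -log y` when `y ≤ 1`, and `2 (y - 1) / (y + 1) ≤ log y` when `1 ≤ y`. Equality holds at `y =
1`. -/
lemma two_mul_add_sub_le_div_add_log {x y : ℝ} (hy : 0 < y) (hxy : y ≤ x) (hx : 1 ≤ x) :
    2 * (x + y) - x * y - 2 ≤ x / y + 2 * Real.log y := by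
  have hquad : x / y = x * ((1 - y) ^ 2 / y) - x * y + 2 * x := by field_simp; ring
  have hnn : 0 ≤ (1 - y) ^ 2 / y := by positivity
  rcases le_total y 1 with h | h
  · have h1 : (1 - y) ^ 2 / y ≤ x * ((1 - y) ^ 2 / y) := le_mul_of_one_le_left hnn hx
    have h2 : -Real.log y ≤ Real.sinh (-Real.log y) :=
      Real.self_le_sinh_iff.2 (by linarith [Real.log_nonpos hy.le h])
    rw [Real.sinh_eq, neg_neg, Real.exp_neg, Real.exp_log hy] at h2
    have h3 : (1 - y) ^ 2 / y = y⁻¹ - 2 + y := by field_simp; ring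
    linarith
  · have h1 : y * ((1 - y) ^ 2 / y) ≤ x * ((1 - y) ^ 2 / y) := mul_le_mul_of_nonneg_right hxy hnn
    have h2 := Real.le_log_one_add_of_nonneg (sub_nonneg.2 h)
    rw [add_sub_cancel] at h2
    have h3 : y * ((1 - y) ^ 2 / y) = (1 - y) ^ 2 := by field_simp
    have h4 : (1 - y) ^ 2 + 2 * (2 * (y - 1) / (y - 1 + 2)) - 2 * y + 2
        = (y - 1) ^ 3 / (y + 1) := by
      have : y + 1 ≠ 0 := by positivity
      rw [show y - 1 + 2 = y + 1 by ring]; field_simp; ring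
    have h5 : 0 ≤ (y - 1) ^ 3 / (y + 1) := by
      have := sub_nonneg.2 h
      positivity
    linarith

/-- The function supporting `W₀ - 1 / det` at `G` along all rank-one lines through `G`; it is affine
along rank-one lines. -/
def rankOneSupport (G F : Mat) : ℝ :=
  4 * ((conf G).re * (conf F).re + (conf G).im * (conf F).im) / (‖conf G‖ * lamMin G)
    - F.det / lamMin G ^ 2 - 2 + 2 * Real.log (lamMin G)

/-- The hypothesis says `‖conf F - conf G‖ = ‖anti F - anti G‖`; the triangle inequality on both
sides gives the claim. -/
lemma lamMin_le_lamMax_of_det_sub_eq_zero {F G : Mat} (hF : F ∈ GLp) (hG : G ∈ GLp)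
    (h : (F - G).det = 0) : lamMin G ≤ lamMax F := by
  rw [lamMin_eq hG, lamMax_eq hF]
  have hc : conf (F - G) = conf F - conf G := by
    apply Complex.ext <;> simp [conf] <;> ring
  have ha : anti (F - G) = anti F - anti G := by
    apply Complex.ext <;> simp [anti] <;> ring
  rw [det_eq, hc, ha, sub_eq_zero] at h
  have h' := (pow_left_inj₀ (norm_nonneg _) (norm_nonneg _) two_ne_zero).1 h
  have h1 := norm_sub_norm_le (conf G) (conf F)
  have h2 := norm_sub_le (anti F) (anti G)
  rw [norm_sub_rev] at h1
  linarith

/-- This is the scalar inequality for the singular values of `F` divided by `lamMin G`. By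
Cauchy–Schwarz, `‖conf F‖` is then replaced by the component of `conf F` along `conf G`, which is
linear in `F`. -/
lemma rankOneSupport_le {F G : Mat} (hF : F ∈ GLp) (hG : G ∈ GLp) (h : (F - G).det = 0) :
    rankOneSupport G F + 1 / F.det ≤ W₀ F := by
  have hμ := lamMin_pos hG
  have hy := lamMin_pos hF
  have hxμ := lamMin_le_lamMax_of_det_sub_eq_zero hF hG h
  have hc : 0 < ‖conf G‖ := (norm_nonneg _).trans_lt (norm_anti_lt_norm_conf hG)
  have key := two_mul_add_sub_le_div_add_log (div_pos hy hμ)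
    (div_le_div_of_nonneg_right (lamMin_le_lamMax F) hμ.le) ((one_le_div hμ).2 hxμ)
  rw [Real.log_div hy.ne' hμ.ne', div_div_div_cancel_right₀ hμ.ne', ← add_div,
    lamMax_add_lamMin hF, div_mul_div_comm, lamMax_mul_lamMin hF] at key
  have hin : (conf G).re * (conf F).re + (conf G).im * (conf F).im ≤ ‖conf G‖ * ‖conf F‖ := by
    have := (Complex.re_le_norm (star (conf G) * conf F))
    rw [norm_mul, norm_star] at this
    simpa [Complex.mul_re] using this
  have hin' : 4 * ((conf G).re * (conf F).re + (conf G).im * (conf F).im)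
      / (‖conf G‖ * lamMin G) ≤ 2 * (2 * ‖conf F‖ / lamMin G) := by
    rw [div_le_iff₀ (by positivity)]
    have : 2 * (2 * ‖conf F‖ / lamMin G) * (‖conf G‖ * lamMin G) = 4 * (‖conf G‖ * ‖conf F‖) := by
      field_simp; ring
    linarith
  rw [W₀_eq hF, rankOneSupport, pow_two]
  linarith

lemma rankOneSupport_self {G : Mat} (hG : G ∈ GLp) :
    rankOneSupport G G + 1 / G.det = W₀ G := by
  have hμ := (lamMin_pos hG).ne'
  have hc : ‖conf G‖ ≠ 0 := ((norm_nonneg _).trans_lt (norm_anti_lt_norm_conf hG)).ne'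
  have hin : (conf G).re * (conf G).re + (conf G).im * (conf G).im = ‖conf G‖ ^ 2 := by
    rw [Complex.sq_norm, Complex.normSq_apply]
  have h1 : 4 * ‖conf G‖ ^ 2 / (‖conf G‖ * lamMin G) = 2 * (lamMax G + lamMin G) / lamMin G := by
    rw [lamMax_add_lamMin hG]
    field_simp; ring
  rw [W₀_eq hG, rankOneSupport, hin, h1, ← lamMax_mul_lamMin hG]
  field_simp
  ring

lemma det_eq_zero_of_rank_eq_one {H : Mat} (hH : H.rank = 1) : H.det = 0 := by
  by_contra h
  have := Matrix.rank_of_isUnit H ((Matrix.isUnit_iff_isUnit_det H).2 (isUnit_iff_ne_zero.2 h))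
  simp [hH] at this

lemma isRankOneConvex_W₀ : IsRankOneConvex W₀ := by
  intro F hF H hH hFH t ht
  have hH0 := det_eq_zero_of_rank_eq_one hH
  have h1t : 0 ≤ 1 - t := sub_nonneg.2 ht.2
  set G : Mat := (1 - t) • F + t • (F + H) with hGdef
  have hFd : 0 < F.det := hF
  have hFHd : 0 < (F + H).det := hFH
  have hentry (i j : Fin 2) : G i j = F i j + t * H i j := by
    simp only [hGdef, Matrix.add_apply, Matrix.smul_apply, smul_eq_mul]; ring
  have hdet : G.det = (1 - t) * F.det + t * (F + H).det := by
    rw [Matrix.det_fin_two] at hH0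
    simp only [Matrix.det_fin_two, hentry, Matrix.add_apply]
    linear_combination (t ^ 2 - t) * hH0
  have hmin : 0 < G.det := by
    rcases ht.1.eq_or_lt with h | h
    · rw [hdet, ← h]; simpa using hFd
    · rw [hdet]; linarith [mul_nonneg h1t hFd.le, mul_pos h hFHd]
  have hGp : G ∈ GLp := hmin
  have hFG : (F - G).det = 0 := by
    rw [Matrix.det_fin_two] at hH0 ⊢
    simp only [hentry, Matrix.sub_apply]
    linear_combination t ^ 2 * hH0
  have hFHG : (F + H - G).det = 0 := by
    rw [Matrix.det_fin_two] at hH0 ⊢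
    simp only [hentry, Matrix.sub_apply, Matrix.add_apply]
    linear_combination (1 - t) ^ 2 * hH0
  have haff : rankOneSupport G G
      = (1 - t) * rankOneSupport G F + t * rankOneSupport G (F + H) := by
    have hre : (conf G).re = (1 - t) * (conf F).re + t * (conf (F + H)).re := by
      simp only [conf, hentry, Matrix.add_apply]; ring
    have him : (conf G).im = (1 - t) * (conf F).im + t * (conf (F + H)).im := by
      simp only [conf, hentry, Matrix.add_apply]; ring
    -- Only the second argument of `rankOneSupport G G` may be expanded, so the coefficients
    -- depending on `G` are kept as separate variables.
    have aux (a b p q m L : ℝ) (hp : p = (1 - t) * (conf F).re + t * (conf (F + H)).re)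
        (hq : q = (1 - t) * (conf F).im + t * (conf (F + H)).im)
        (d : ℝ) (hd : d = (1 - t) * F.det + t * (F + H).det) :
        4 * (a * p + b * q) / m - d / L ^ 2 - 2 + 2 * Real.log L
          = (1 - t) * (4 * (a * (conf F).re + b * (conf F).im) / m - F.det / L ^ 2 - 2
              + 2 * Real.log L)
            + t * (4 * (a * (conf (F + H)).re + b * (conf (F + H)).im) / m
              - (F + H).det / L ^ 2 - 2 + 2 * Real.log L) := by
      subst hp hq hd; ring
    exact aux _ _ _ _ _ _ hre him _ hdet
  have hinv : 1 / G.det ≤ (1 - t) * (1 / F.det) + t * (1 / (F + H).det) := by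
    rw [div_le_iff₀ hmin, hdet]
    have : ((1 - t) * (1 / F.det) + t * (1 / (F + H).det)) * ((1 - t) * F.det + t * (F + H).det)
        = 1 + t * (1 - t) * ((F.det - (F + H).det) ^ 2 / (F.det * (F + H).det)) := by
      field_simp; ring
    rw [this]
    have ht0 := ht.1
    have : 0 ≤ t * (1 - t) * ((F.det - (F + H).det) ^ 2 / (F.det * (F + H).det)) := by positivity
    linarith
  have e1 := mul_le_mul_of_nonneg_left (rankOneSupport_le hF hGp hFG) h1t
  have e2 := mul_le_mul_of_nonneg_left (rankOneSupport_le hFH hGp hFHG) ht.1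
  rw [← rankOneSupport_self hGp, haff]
  linarith

/-! ### Failure of polyconvexity -/

lemma diag_mem_GLp {a b : ℝ} (ha : 0 < a) (hb : 0 < b) : (!![a, 0; 0, b] : Mat) ∈ GLp := by
  rw [GLp, Set.mem_ofPred_eq, Matrix.det_fin_two_of]
  simpa using mul_pos ha hb

lemma W₀_diag {a b : ℝ} (ha : 0 < a) (hb : 0 < b) :
    W₀ !![a, 0; 0, b] = max a b / min a b + 2 * Real.log (min a b) + 1 / (a * b) := by
  have hm := diag_mem_GLp ha hb
  have hc : ‖conf !![a, 0; 0, b]‖ = (a + b) / 2 := by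
    have : conf !![a, 0; 0, b] = (((a + b) / 2 : ℝ) : ℂ) := by
      apply Complex.ext <;> simp [conf, -Complex.ofReal_div, -Complex.ofReal_add]
    rw [this, Complex.norm_real, Real.norm_of_nonneg (by positivity)]
  have hd : ‖anti !![a, 0; 0, b]‖ = |a - b| / 2 := by
    have : anti !![a, 0; 0, b] = (((a - b) / 2 : ℝ) : ℂ) := by
      apply Complex.ext <;> simp [anti, -Complex.ofReal_div, -Complex.ofReal_sub]
    rw [this, Complex.norm_real, Real.norm_eq_abs, abs_div, abs_two]
  rw [W₀_eq hm, lamMax_eq hm, lamMin_eq hm, hc, hd, Matrix.det_fin_two_of, ← add_div, ← sub_div]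
  rcases le_total a b with h | h
  · rw [abs_of_nonpos (sub_nonpos.2 h), max_eq_right h, min_eq_left h]
    ring_nf
  · rw [abs_of_nonneg (sub_nonneg.2 h), max_eq_left h, min_eq_right h]
    ring_nf

lemma IsConvexExt.le_of_le {E : Type*} [AddCommGroup E] [Module ℝ E] {P : E → WithTop ℝ}
    (hP : IsConvexExt P) {x y : E} {u v a b : ℝ} (hx : P x ≤ (u : WithTop ℝ))
    (hy : P y ≤ (v : WithTop ℝ)) (ha : 0 ≤ a) (hb : 0 ≤ b) (hab : a + b = 1) :
    P (a • x + b • y) ≤ ((a * u + b * v : ℝ) : WithTop ℝ) := by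
  refine (hP x y a b ha hb hab).trans ?_
  obtain ⟨p, hp⟩ := WithTop.ne_top_iff_exists.1 (ne_top_of_le_ne_top WithTop.coe_ne_top hx)
  obtain ⟨q, hq⟩ := WithTop.ne_top_iff_exists.1 (ne_top_of_le_ne_top WithTop.coe_ne_top hy)
  rw [← hp, WithTop.coe_le_coe] at hx
  rw [← hq, WithTop.coe_le_coe] at hy
  rw [← hp, ← hq, ← WithTop.coe_mul, ← WithTop.coe_mul, ← WithTop.coe_add, WithTop.coe_le_coe]
  gcongr

lemma not_isPolyconvex_W₀ : ¬ IsPolyconvex W₀ := by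
  rintro ⟨P, hP, hPW⟩
  have hval {a b : ℝ} (ha : 0 < a) (hb : 0 < b) : P (!![a, 0; 0, b], a * b)
      = ((max a b / min a b + 2 * Real.log (min a b) + 1 / (a * b) : ℝ) : WithTop ℝ) := by
    rw [← W₀_diag ha hb, ← hPW _ (diag_mem_GLp ha hb), Matrix.det_fin_two_of]; simp
  -- Weights `16/25`, `9/50`, `9/50` on `9 • 1`, `diag(54, 14)`, `diag(14, 54)` average to `18 • 1`,
  -- and the determinants `81`, `756`, `756` to `18 ^ 2`. At this scale the term `1 / det` is
  -- negligible.
  have h9 := hval (a := 9) (b := 9) (by norm_num) (by norm_num)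
  have h18 := hval (a := 18) (b := 18) (by norm_num) (by norm_num)
  have h54 := hval (a := 54) (b := 14) (by norm_num) (by norm_num)
  have h14 := hval (a := 14) (b := 54) (by norm_num) (by norm_num)
  have hmid := hP.le_of_le h54.le h14.le (a := 1 / 2) (b := 1 / 2) (by norm_num) (by norm_num)
    (by norm_num)
  have hall := hP.le_of_le h9.le hmid (a := 16 / 25) (b := 9 / 25) (by norm_num) (by norm_num)
    (by norm_num)
  have hpt : (16 / 25 : ℝ) • ((!![9, 0; 0, 9] : Mat), (9 * 9 : ℝ))
      + (9 / 25 : ℝ) • ((1 / 2 : ℝ) • ((!![54, 0; 0, 14] : Mat), (54 * 14 : ℝ))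
        + (1 / 2 : ℝ) • ((!![14, 0; 0, 54] : Mat), (14 * 54 : ℝ)))
      = (!![18, 0; 0, 18], 18 * 18) := by
    refine Prod.ext ?_ ?_
    · ext i j
      fin_cases i <;> fin_cases j <;> norm_num [Matrix.smul_apply]
    · norm_num
  rw [hpt, h18, WithTop.coe_le_coe] at hall
  norm_num at hall
  have l18 : Real.log 18 = Real.log 2 + Real.log 9 := by
    rw [← Real.log_mul (by norm_num) (by norm_num)]; norm_num
  have l14 : Real.log 14 = Real.log 2 + Real.log 7 := by
    rw [← Real.log_mul (by norm_num) (by norm_num)]; norm_num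
  have l79 : Real.log 7 - Real.log 9 ≤ 7 / 9 - 1 := by
    rw [← Real.log_div (by norm_num) (by norm_num)]
    exact Real.log_le_sub_one_of_pos (by norm_num)
  have l2 := Real.log_two_gt_d9
  rw [l18, l14] at hall
  linarith

/-! ### Polar coordinates on `GLp` -/

/-- The matrix with conformal part `e ^ τ * cosh θ * e ^ (i α)` and anticonformal part
`e ^ τ * sinh θ * e ^ (i β)`, for the parameters `((α, β), (θ, τ))`. Its singular values are
`e ^ (τ + θ)` and `e ^ (τ - θ)` when `0 ≤ θ`. -/
def polarMatrix (p : (ℝ × ℝ) × (ℝ × ℝ)) : Mat :=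
  let r := Real.exp p.2.2 * Real.cosh p.2.1
  let s := Real.exp p.2.2 * Real.sinh p.2.1
  !![r * Real.cos p.1.1 + s * Real.cos p.1.2, s * Real.sin p.1.2 - r * Real.sin p.1.1;
     r * Real.sin p.1.1 + s * Real.sin p.1.2, r * Real.cos p.1.1 - s * Real.cos p.1.2]

lemma continuous_polarMatrix : Continuous polarMatrix := by
  refine continuous_matrix fun i j => ?_
  fin_cases i <;> fin_cases j <;> simp [polarMatrix] <;> fun_prop

lemma conf_polarMatrix (p : (ℝ × ℝ) × (ℝ × ℝ)) :
    conf (polarMatrix p) = (Real.exp p.2.2 * Real.cosh p.2.1 : ℝ)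
      * (Real.cos p.1.1 + Real.sin p.1.1 * Complex.I) := by
  apply Complex.ext
  all_goals
    simp only [conf, polarMatrix, Complex.re_ofReal_mul, Complex.im_ofReal_mul]
    simp [-Complex.ofReal_cos, -Complex.ofReal_sin] <;> ring

lemma anti_polarMatrix (p : (ℝ × ℝ) × (ℝ × ℝ)) :
    anti (polarMatrix p) = (Real.exp p.2.2 * Real.sinh p.2.1 : ℝ)
      * (Real.cos p.1.2 + Real.sin p.1.2 * Complex.I) := by
  apply Complex.ext
  all_goals
    simp only [anti, polarMatrix, Complex.re_ofReal_mul, Complex.im_ofReal_mul]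
    simp [-Complex.ofReal_cos, -Complex.ofReal_sin] <;> ring

lemma ext_conf_anti {F G : Mat} (hc : conf F = conf G) (ha : anti F = anti G) : F = G := by
  have h1 := congrArg Complex.re hc
  have h2 := congrArg Complex.im hc
  have h3 := congrArg Complex.re ha
  have h4 := congrArg Complex.im ha
  simp only [conf, anti] at h1 h2 h3 h4
  ext i j
  fin_cases i <;> fin_cases j <;> simp <;> linarith

lemma norm_cos_add_sin_mul_I (a : ℝ) : ‖(Real.cos a : ℂ) + Real.sin a * Complex.I‖ = 1 := by
  rw [Complex.ofReal_cos, Complex.ofReal_sin, ← Complex.exp_mul_I, Complex.norm_exp_ofReal_mul_I]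

lemma norm_conf_polarMatrix (p : (ℝ × ℝ) × (ℝ × ℝ)) :
    ‖conf (polarMatrix p)‖ = Real.exp p.2.2 * Real.cosh p.2.1 := by
  have := Real.cosh_pos p.2.1
  rw [conf_polarMatrix, norm_mul, norm_cos_add_sin_mul_I, mul_one, Complex.norm_real,
    Real.norm_of_nonneg (by positivity)]

lemma norm_anti_polarMatrix {p : (ℝ × ℝ) × (ℝ × ℝ)} (hp : 0 ≤ p.2.1) :
    ‖anti (polarMatrix p)‖ = Real.exp p.2.2 * Real.sinh p.2.1 := by
  have := Real.sinh_nonneg_iff.2 hp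
  rw [anti_polarMatrix, norm_mul, norm_cos_add_sin_mul_I, mul_one, Complex.norm_real,
    Real.norm_of_nonneg (by positivity)]

/-- The energy in terms of half the logarithms of distortion and determinant. -/
def logEnergy (q : ℝ × ℝ) : ℝ := Real.exp (2 * q.1) - 2 * q.1 + (Real.exp (-2 * q.2) + 2 * q.2)

lemma det_polarMatrix {p : (ℝ × ℝ) × (ℝ × ℝ)} (hp : 0 ≤ p.2.1) :
    (polarMatrix p).det = Real.exp (2 * p.2.2) := by
  rw [det_eq, norm_conf_polarMatrix, norm_anti_polarMatrix hp, two_mul, Real.exp_add]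
  linear_combination Real.exp p.2.2 ^ 2 * Real.cosh_sq_sub_sinh_sq p.2.1

lemma polarMatrix_mem_GLp {p : (ℝ × ℝ) × (ℝ × ℝ)} (hp : 0 ≤ p.2.1) : polarMatrix p ∈ GLp := by
  rw [GLp, Set.mem_ofPred_eq, det_polarMatrix hp]; positivity

lemma W₀_polarMatrix {p : (ℝ × ℝ) × (ℝ × ℝ)} (hp : 0 ≤ p.2.1) :
    W₀ (polarMatrix p) = logEnergy p.2 := by
  have hm := polarMatrix_mem_GLp hp
  rw [W₀_eq hm, lamMax_eq hm, lamMin_eq hm, det_polarMatrix hp, norm_conf_polarMatrix,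
    norm_anti_polarMatrix hp, ← mul_add, ← mul_sub, Real.cosh_add_sinh, Real.cosh_sub_sinh,
    ← Real.exp_add, ← Real.exp_add, Real.log_exp, ← Real.exp_sub, one_div, ← Real.exp_neg,
    logEnergy]
  ring_nf

/-- Parameters of the matrices in a sublevel set. -/
def polarSublevel (c : ℝ) : Set ((ℝ × ℝ) × (ℝ × ℝ)) :=
  (Set.Icc (-Real.pi) Real.pi ×ˢ Set.Icc (-Real.pi) Real.pi) ×ˢ {q | 0 ≤ q.1 ∧ logEnergy q ≤ c}

lemma exists_polarMatrix_eq {F : Mat} (hF : F ∈ GLp) :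
    ∃ p : (ℝ × ℝ) × (ℝ × ℝ), p.1 ∈ Set.Icc (-Real.pi) Real.pi ×ˢ Set.Icc (-Real.pi) Real.pi ∧
      0 ≤ p.2.1 ∧ polarMatrix p = F := by
  have hx := lamMax_pos hF
  have hy := lamMin_pos hF
  set u := Real.log (lamMax F)
  set v := Real.log (lamMin F)
  have hux : Real.exp u = lamMax F := Real.exp_log hx
  have hvy : Real.exp v = lamMin F := Real.exp_log hy
  have e1 : Real.exp ((u + v) / 2) * Real.exp ((u - v) / 2) = lamMax F := by
    rw [← hux, ← Real.exp_add]; ring_nf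
  have e2 : Real.exp ((u + v) / 2) * Real.exp (-((u - v) / 2)) = lamMin F := by
    rw [← hvy, ← Real.exp_add]; ring_nf
  -- When `anti F = 0` its argument is the default `0`, which is harmless as the radius vanishes.
  refine ⟨((Complex.arg (conf F), Complex.arg (anti F)), ((u - v) / 2, (u + v) / 2)),
    ⟨⟨(Complex.neg_pi_lt_arg _).le, Complex.arg_le_pi _⟩,
      ⟨(Complex.neg_pi_lt_arg _).le, Complex.arg_le_pi _⟩⟩, ?_, ?_⟩
  · have := Real.log_le_log hy (lamMin_le_lamMax F)
    simp only
    linarith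
  · apply ext_conf_anti
    · rw [conf_polarMatrix]
      have : Real.exp ((u + v) / 2) * Real.cosh ((u - v) / 2) = ‖conf F‖ := by
        rw [Real.cosh_eq]; linarith [lamMax_add_lamMin hF]
      simp only [this]
      exact_mod_cast Complex.norm_mul_cos_add_sin_mul_I (conf F)
    · rw [anti_polarMatrix]
      have : Real.exp ((u + v) / 2) * Real.sinh ((u - v) / 2) = ‖anti F‖ := by
        rw [Real.sinh_eq]; linarith [lamMax_sub_lamMin hF]
      simp only [this]
      exact_mod_cast Complex.norm_mul_cos_add_sin_mul_I (anti F)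

/-! ### Compactness and connectedness of sublevel sets -/

lemma sublevel_eq_image (c : ℝ) : sublevel W₀ c = polarMatrix '' polarSublevel c := by
  ext F
  constructor
  · rintro ⟨hF, hc⟩
    obtain ⟨p, hp1, hp2, rfl⟩ := exists_polarMatrix_eq hF
    exact ⟨p, ⟨hp1, hp2, by rwa [← W₀_polarMatrix hp2]⟩, rfl⟩
  · rintro ⟨p, ⟨-, hp2, hc⟩, rfl⟩
    exact ⟨polarMatrix_mem_GLp hp2, by rwa [W₀_polarMatrix hp2]⟩

/-- Coercivity: both summands of `logEnergy` have the form `exp x - x`. -/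
lemma abs_le_exp_sub (x : ℝ) : |x| ≤ Real.exp x - x := by
  refine abs_le.2 ⟨by linarith [Real.exp_pos x], ?_⟩
  rcases le_total 0 x with h | h
  · nlinarith [Real.quadratic_le_exp_of_nonneg h, sq_nonneg (x - 1)]
  · linarith [Real.exp_pos x]

lemma continuous_logEnergy : Continuous logEnergy := by
  unfold logEnergy; fun_prop

lemma convexOn_logEnergy : ConvexOn ℝ Set.univ logEnergy := by
  refine ⟨convex_univ, fun x _ y _ a b ha hb hab => ?_⟩
  have h1 := convexOn_exp.2 (Set.mem_univ (2 * x.1)) (Set.mem_univ (2 * y.1)) ha hb hab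
  have h2 := convexOn_exp.2 (Set.mem_univ (-2 * x.2)) (Set.mem_univ (-2 * y.2)) ha hb hab
  simp only [smul_eq_mul] at h1 h2
  simp only [logEnergy, Prod.fst_add, Prod.snd_add, Prod.smul_fst, Prod.smul_snd, smul_eq_mul]
  rw [show 2 * (a * x.1 + b * y.1) = a * (2 * x.1) + b * (2 * y.1) by ring,
    show -2 * (a * x.2 + b * y.2) = a * (-2 * x.2) + b * (-2 * y.2) by ring]
  linarith

lemma isCompact_polarSublevel (c : ℝ) : IsCompact (polarSublevel c) := by
  refine (isCompact_Icc.prod isCompact_Icc).prod ?_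
  have hK : IsCompact (Set.Icc (-c) c ×ˢ Set.Icc (-c) c) := isCompact_Icc.prod isCompact_Icc
  refine hK.of_isClosed_subset ?_ ?_
  · exact (isClosed_le continuous_const continuous_fst).inter
      (isClosed_le continuous_logEnergy continuous_const)
  · rintro q ⟨-, hq⟩
    have h1 := abs_le_exp_sub (2 * q.1)
    have h2 := abs_le_exp_sub (-2 * q.2)
    rw [logEnergy] at hq
    have h3 := abs_nonneg (2 * q.1)
    have h4 := abs_nonneg (-2 * q.2)
    have h5 : |2 * q.1| ≤ c := by linarith
    have h6 : |-2 * q.2| ≤ c := by linarith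
    rw [abs_le] at h5 h6
    exact ⟨⟨by linarith, by linarith⟩, ⟨by linarith, by linarith⟩⟩

lemma convex_polarSublevel (c : ℝ) : Convex ℝ (polarSublevel c) := by
  refine ((convex_Icc _ _).prod (convex_Icc _ _)).prod ?_
  have h1 : Convex ℝ {q : ℝ × ℝ | 0 ≤ q.1} :=
    convex_halfSpace_ge (LinearMap.fst ℝ ℝ ℝ).isLinear 0
  have h2 := convexOn_logEnergy.convex_le c
  convert h1.inter h2 using 1
  ext q
  simp

lemma isCompact_sublevel_W₀ (c : ℝ) : IsCompact (sublevel W₀ c) := by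
  rw [sublevel_eq_image]
  exact (isCompact_polarSublevel c).image continuous_polarMatrix

lemma isPreconnected_sublevel_W₀ (c : ℝ) : IsPreconnected (sublevel W₀ c) := by
  rw [sublevel_eq_image]
  exact (convex_polarSublevel c).isPreconnected.image _ continuous_polarMatrix.continuousOn

end PlanarEnergy

end

/-- Connectedness is `IsPreconnected`: the empty set, which is a sublevel set of `W₀` for small `c`,
counts as connected. -/
theorem mainTheorem1 :
    (∀ F ∈ PlanarEnergy.GLp,
      0 < PlanarEnergy.lamMin F ∧ PlanarEnergy.lamMin F ≤ PlanarEnergy.lamMax F ∧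
      PlanarEnergy.lamMax F = PlanarEnergy.euclOpNorm F ∧
      PlanarEnergy.lamMax F * PlanarEnergy.lamMin F = F.det ∧
      PlanarEnergy.W₀ F =
        PlanarEnergy.hHat (PlanarEnergy.distortion F) + PlanarEnergy.fVol F.det) ∧
    PlanarEnergy.IsObjectiveIsotropic PlanarEnergy.W₀ ∧
    PlanarEnergy.IsRankOneConvex PlanarEnergy.W₀ ∧
    (∀ c : ℝ, IsCompact (PlanarEnergy.sublevel PlanarEnergy.W₀ c) ∧
      IsPreconnected (PlanarEnergy.sublevel PlanarEnergy.W₀ c)) ∧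
    ¬ PlanarEnergy.IsPolyconvex PlanarEnergy.W₀ := by
  open PlanarEnergy in
  exact ⟨fun F hF => ⟨lamMin_pos hF, lamMin_le_lamMax F, lamMax_eq_euclOpNorm F,
      lamMax_mul_lamMin hF, W₀_eq_hHat_add_fVol hF⟩,
    isObjectiveIsotropic_W₀, isRankOneConvex_W₀,
    fun c => ⟨isCompact_sublevel_W₀ c, isPreconnected_sublevel_W₀ c⟩, not_isPolyconvex_W₀⟩
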